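/- Let $a_{ij}\in\mathbb{R}$ ($i,j\in\{1,2\}$) and let $D=\sum_{i,j=1}^{2}a_{ij}\,\partial_i\partial_j$ be the corresponding homogeneous second-order linear differential operator with constant real coefficients on $\mathbb{R}^2$. Let $\Omega\subseteq\mathbb{R}^2$ be a nonempty bounded open set and let $p\in(0,1)$. Then there exists a constant $c_p>0$, depending only on $D$, $\Omega$ and $p$, such that every real-valued function $u\in C^2(\Omega)$ with $Du\geq 1$ everywhere on $\Omega$ satisfies $$\|u\|_{L^p(\Omega)}=\left(\int_\Omega |u(x)|^p\,dx\right)^{1/p}\geq c_p,$$ where the left-hand side is $+\infty$ if the integral diverges. -/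

import Mathlib

open MeasureTheory

/-- The partial derivative `∂f/∂xᵢ` of a real function on the Euclidean plane. -/
noncomputable def partialDeriv (i : Fin 2) (f : EuclideanSpace ℝ (Fin 2) → ℝ) :
    EuclideanSpace ℝ (Fin 2) → ℝ :=
  fun x => lineDeriv ℝ f x (EuclideanSpace.single i 1)

/-- The linear homogeneous second order differential operator on the plane with constant
coefficients `a i j`, that is `D u = ∑ i, ∑ j, a i j * ∂ᵢ ∂ⱼ u`. -/
noncomputable def secondOrderOp (a : Matrix (Fin 2) (Fin 2) ℝ)
    (u : EuclideanSpace ℝ (Fin 2) → ℝ) : EuclideanSpace ℝ (Fin 2) → ℝ :=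
  fun x => ∑ i : Fin 2, ∑ j : Fin 2, a i j * partialDeriv i (partialDeriv j u) x

open Metric Set Filter Topology

/-! A cutoff reduces the problem to a globally C² function on a ball `ball x₀ R` inside Ω; symmetry
of second derivatives turns D into a symmetric matrix A = (α, β; β, γ).

If det A ≤ 0, the quadratic form of A splits into real linear factors, so D = ∂_v ∂_w. Then Du ≥ 1
forces the alternating sum of u over the corners of a parallelogram with sides tv, tw to be at least
t². Since |·|^p is subadditive for p < 1, integrating over the base point bounds ∫|u|^p below
(`exists_le_integral_of_nonelliptic`).

If A is definite, replacing u by -u makes it positive definite. A weighted mean value inequality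
adapted to A (`mul_add_le_integral_formWeight_mul`) shows that the weighted mean of u about x
exceeds u(x) by a multiple of ρ². For p < 1, sub-mean-value functions are still bounded above in the
interior by ‖u‖_p (`rpow_mul_max_le`), and at some point u is bounded below by a negative multiple
of ‖u‖_p. The gap of order ρ² is therefore at most a constant times ‖u‖_p
(`exists_le_integral_of_elliptic`). -/

/-- The Euclidean plane. -/
abbrev Plane : Type := EuclideanSpace ℝ (Fin 2)

/-! ### Second derivatives and reduction to globally C² functions -/

/-- The expression `α ∂₀∂₀u + 2β ∂₀∂₁u + γ ∂₁∂₁u` in terms of iterated Fréchet derivatives. -/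
noncomputable def quadHess (α β γ : ℝ) (u : Plane → ℝ) (x : Plane) : ℝ :=
  α * fderiv ℝ (fderiv ℝ u) x (EuclideanSpace.single 0 1) (EuclideanSpace.single 0 1)
  + 2 * β * fderiv ℝ (fderiv ℝ u) x (EuclideanSpace.single 0 1) (EuclideanSpace.single 1 1)
  + γ * fderiv ℝ (fderiv ℝ u) x (EuclideanSpace.single 1 1) (EuclideanSpace.single 1 1)

theorem plane_eq_single_add_single (y : Plane) :
    y = y 0 • EuclideanSpace.single 0 (1 : ℝ) + y 1 • EuclideanSpace.single 1 (1 : ℝ) := by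
  ext i
  fin_cases i <;> simp

theorem ContDiff.differentiable_fderiv {u : Plane → ℝ} (hu : ContDiff ℝ 2 u) :
    Differentiable ℝ (fderiv ℝ u) :=
  (hu.fderiv_right (m := 1) (by norm_num)).differentiable (by norm_num)

theorem ContDiff.continuous_fderiv_fderiv {u : Plane → ℝ} (hu : ContDiff ℝ 2 u) :
    Continuous (fderiv ℝ (fderiv ℝ u)) :=
  (hu.fderiv_right (m := 1) (by norm_num)).continuous_fderiv (by norm_num)

theorem ContDiff.fderiv_fderiv_comm {u : Plane → ℝ} (hu : ContDiff ℝ 2 u) (x v w : Plane) :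
    fderiv ℝ (fderiv ℝ u) x v w = fderiv ℝ (fderiv ℝ u) x w v :=
  (hu.contDiffAt (x := x)).isSymmSndFDerivAt (by simp) v w

theorem quadHess_neg (α β γ : ℝ) (u : Plane → ℝ) (x : Plane) :
    quadHess α β γ (-u) x = quadHess (-α) (-β) (-γ) u x := by
  have h : fderiv ℝ (-u) = -fderiv ℝ u := by
    funext z
    exact fderiv_neg
  have h2 : fderiv ℝ (fderiv ℝ (-u)) x = -fderiv ℝ (fderiv ℝ u) x := by
    rw [h]
    exact fderiv_neg
  simp only [quadHess, h2, neg_apply]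
  ring

theorem partialDeriv_eventuallyEq {u v : Plane → ℝ} {x : Plane} (h : u =ᶠ[𝓝 x] v) (i : Fin 2) :
    partialDeriv i u =ᶠ[𝓝 x] partialDeriv i v :=
  h.eventuallyEq_nhds.mono fun _ hy => hy.lineDeriv_eq

theorem secondOrderOp_congr (a : Matrix (Fin 2) (Fin 2) ℝ) {u v : Plane → ℝ} {x : Plane}
    (h : u =ᶠ[𝓝 x] v) : secondOrderOp a u x = secondOrderOp a v x := by
  simp only [secondOrderOp]
  refine Finset.sum_congr rfl fun i _ => Finset.sum_congr rfl fun j _ => ?_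
  rw [(partialDeriv_eventuallyEq (partialDeriv_eventuallyEq h j) i).eq_of_nhds]

theorem partialDeriv_partialDeriv {u : Plane → ℝ} (hu : ContDiff ℝ 2 u) (i j : Fin 2)
    (x : Plane) : partialDeriv i (partialDeriv j u) x =
      fderiv ℝ (fderiv ℝ u) x (EuclideanSpace.single i 1) (EuclideanSpace.single j 1) := by
  have h : partialDeriv j u = fun z => fderiv ℝ u z (EuclideanSpace.single j 1) := by
    funext z
    exact ((hu.differentiable (by norm_num)) z).lineDeriv_eq_fderiv
  have hd := (hu.differentiable_fderiv x).hasFDerivAt.clm_apply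
    (hasFDerivAt_const (EuclideanSpace.single j (1 : ℝ)) x)
  rw [h, partialDeriv, hd.differentiableAt.lineDeriv_eq_fderiv, hd.fderiv]
  simp

theorem secondOrderOp_eq_quadHess (a : Matrix (Fin 2) (Fin 2) ℝ) {u : Plane → ℝ}
    (hu : ContDiff ℝ 2 u) (x : Plane) :
    secondOrderOp a u x = quadHess (a 0 0) ((a 0 1 + a 1 0) / 2) (a 1 1) u x := by
  simp only [secondOrderOp, Fin.sum_univ_two, partialDeriv_partialDeriv hu, quadHess]
  rw [hu.fderiv_fderiv_comm x (EuclideanSpace.single 1 1) (EuclideanSpace.single 0 1)]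
  ring

/-- Multiply u by a bump supported in the larger ball: u may be arbitrary outside Ω, but the product
vanishes near every such point. Agreement of germs, not just values, is what transfers D. -/
theorem ContDiffOn.exists_contDiff_eventuallyEq {u : Plane → ℝ} {Ω : Set Plane} (hΩ : IsOpen Ω)
    (hu : ContDiffOn ℝ 2 u Ω) {x₀ : Plane} {R : ℝ} (hR : 0 < R)
    (hB : closedBall x₀ (2 * R) ⊆ Ω) :
    ∃ v : Plane → ℝ, ContDiff ℝ 2 v ∧ ∀ x ∈ ball x₀ R, v =ᶠ[𝓝 x] u := by
  let χ : ContDiffBump x₀ := ⟨R, 2 * R, hR, by linarith⟩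
  refine ⟨fun x => χ x * u x, contDiff_iff_contDiffAt.2 fun x => ?_, fun x hx => ?_⟩
  · by_cases hx : x ∈ Ω
    · exact χ.contDiffAt.mul (hu.contDiffAt (hΩ.mem_nhds hx))
    · have hx' : x ∉ tsupport χ := by
        rw [χ.tsupport_eq]
        exact fun h => hx (hB h)
      have : (fun x => χ x * u x) =ᶠ[𝓝 x] fun _ => 0 := by
        filter_upwards [notMem_tsupport_iff_eventuallyEq.1 hx'] with y hy
        simp [hy]
      exact contDiffAt_const.congr_of_eventuallyEq this
  · filter_upwards [χ.eventuallyEq_one_of_mem_ball hx] with y hy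
    simp [hy]

theorem setIntegral_comp_add_smul_le {f : Plane → ℝ} (hf : Continuous f) (hf0 : ∀ y, 0 ≤ f y)
    {A B : Set Plane} (hA : MeasurableSet A) (hB : MeasurableSet B)
    (hBb : Bornology.IsBounded B)
    {x : Plane} {ρ : ℝ} (hρ : 0 < ρ) (hAB : ∀ y ∈ A, x + ρ • y ∈ B) :
    ∫ y in A, f (x + ρ • y) ≤ (ρ ^ 2)⁻¹ * ∫ y in B, f y := by
  have hint : Integrable (B.indicator f) :=
    (integrable_indicator_iff hB).2
      ((hf.continuousOn.integrableOn_compact hBb.isCompact_closure).mono_set subset_closure)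
  have h1 : ∫ y, B.indicator f (x + ρ • y) = (ρ ^ 2)⁻¹ * ∫ y in B, f y := by
    rw [Measure.integral_comp_smul_of_nonneg volume (fun y => B.indicator f (x + y)) ρ
      (hR := hρ.le), integral_add_left_eq_self, integral_indicator hB]
    simp
  rw [← h1, ← integral_indicator hA]
  refine integral_mono_of_nonneg (ae_of_all _ fun y => indicator_nonneg (fun z _ => hf0 _) _)
    ?_ (ae_of_all _ fun y => ?_)
  · exact (hint.comp_add_left x).comp_smul hρ.ne'
  · by_cases hy : y ∈ A
    · simp [hy, hAB y hy]
    · simpa [hy] using indicator_nonneg (fun z _ => hf0 z) _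

/-! ### Non-elliptic operators: factorization and second differences -/

/-- Two applications of the mean value theorem, first along v to the difference in direction w, then
along w. -/
theorem ContDiff.le_second_difference {u : Plane → ℝ} (hu : ContDiff ℝ 2 u) {x v w : Plane}
    {t : ℝ} (ht : 0 < t)
    (h : ∀ r ∈ Icc 0 t, ∀ s ∈ Icc 0 t, 1 ≤ fderiv ℝ (fderiv ℝ u) (x + r • v + s • w) v w) :
    t ^ 2 ≤ u (x + t • v + t • w) - u (x + t • v) - u (x + t • w) + u x := by
  have hline : ∀ (z v : Plane) (r : ℝ), HasDerivAt (fun r : ℝ => z + r • v) v r := fun z v r => by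
    simpa using ((hasDerivAt_id r).smul_const v).const_add z
  have hud := hu.differentiable (by norm_num)
  have hg : ∀ r : ℝ, HasDerivAt (fun r : ℝ => u (x + t • w + r • v) - u (x + r • v))
      (fderiv ℝ u (x + t • w + r • v) v - fderiv ℝ u (x + r • v) v) r := fun r =>
    ((hud _).hasFDerivAt.comp_hasDerivAt r (hline _ v r)).sub
      ((hud _).hasFDerivAt.comp_hasDerivAt r (hline _ v r))
  obtain ⟨r, hr, hr'⟩ := exists_hasDerivAt_eq_slope _ _ ht
    (continuousOn_of_forall_continuousAt fun r _ => (hg r).continuousAt) fun r _ => hg r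
  have hk : ∀ s : ℝ, HasDerivAt (fun s : ℝ => fderiv ℝ u (x + r • v + s • w) v)
      (fderiv ℝ (fderiv ℝ u) (x + r • v + s • w) w v) s := fun s => by
    simpa using ((hu.differentiable_fderiv _).hasFDerivAt.comp_hasDerivAt s
      (hline (x + r • v) w s)).clm_apply (hasDerivAt_const s v)
  obtain ⟨s, hs, hs'⟩ := exists_hasDerivAt_eq_slope _ _ ht
    (continuousOn_of_forall_continuousAt fun r _ => (hk r).continuousAt) fun r _ => hk r
  have h1 := h r ⟨hr.1.le, hr.2.le⟩ s ⟨hs.1.le, hs.2.le⟩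
  rw [hu.fderiv_fderiv_comm, hs', le_div_iff₀ (by linarith)] at h1
  rw [eq_div_iff (by linarith)] at hr'
  simp only [zero_smul, add_zero, sub_zero] at h1 hr'
  rw [add_right_comm x (r • v) (t • w)] at h1
  rw [add_right_comm x (t • v) (t • w)]
  nlinarith

/-- For α ≠ 0 and s = √(β² - αγ), αX² + 2βXY + γY² = (X + (β+s)/α · Y)(αX + (β-s)Y); for α = 0 it is
Y(2βX + γY). The coefficients of the factors are v and w. -/
theorem quadHess_eq_of_nonelliptic {α β γ : ℝ} (h : α * γ - β ^ 2 ≤ 0) :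
    ∃ v w : Plane, ∀ u : Plane → ℝ, ContDiff ℝ 2 u → ∀ x,
      quadHess α β γ u x = fderiv ℝ (fderiv ℝ u) x v w := by
  have key : ∀ v w : Plane, v 0 * w 0 = α → v 0 * w 1 + v 1 * w 0 = 2 * β → v 1 * w 1 = γ →
      ∀ u : Plane → ℝ, ContDiff ℝ 2 u → ∀ x,
      quadHess α β γ u x = fderiv ℝ (fderiv ℝ u) x v w := by
    intro v w h1 h2 h3 u hu x
    conv_rhs => rw [plane_eq_single_add_single v, plane_eq_single_add_single w]
    simp only [map_add, map_smul, add_apply, smul_apply,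
      smul_eq_mul, quadHess]
    rw [hu.fderiv_fderiv_comm x (EuclideanSpace.single 1 1) (EuclideanSpace.single 0 1),
      ← h1, ← h2, ← h3]
    ring
  by_cases hα : α = 0
  · exact ⟨!₂[0, 1], !₂[2 * β, γ], key _ _ (by simp [hα]) (by simp) (by simp)⟩
  · have hs := Real.sq_sqrt (show 0 ≤ β ^ 2 - α * γ by linarith)
    set s := √(β ^ 2 - α * γ)
    refine ⟨!₂[1, (β + s) / α], !₂[α, β - s], key _ _ (by simp) ?_ ?_⟩
    · simp
      field_simp
      ring
    · simp
      field_simp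
      linarith

theorem abs_add_rpow_le {p : ℝ} (hp0 : 0 < p) (hp1 : p < 1) (a b : ℝ) :
    |a + b| ^ p ≤ |a| ^ p + |b| ^ p :=
  (Real.rpow_le_rpow (abs_nonneg _) (abs_add_le a b) hp0.le).trans
    (Real.rpow_add_le_add_rpow (abs_nonneg _) (abs_nonneg _) hp0.le hp1.le)

theorem Continuous.abs_rpow {X : Type*} [TopologicalSpace X] {u : X → ℝ} (hu : Continuous u)
    {p : ℝ} (hp : 0 < p) : Continuous fun x => |u x| ^ p :=
  hu.abs.rpow_const fun _ => Or.inr hp.le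

theorem Continuous.integrableOn_ball {f : Plane → ℝ} (hf : Continuous f) (x : Plane) (r : ℝ) :
    IntegrableOn f (ball x r) :=
  (hf.continuousOn.integrableOn_compact (isCompact_closedBall x r)).mono_set ball_subset_closedBall

theorem exists_le_integral_of_nonelliptic {α β γ : ℝ} (h : α * γ - β ^ 2 ≤ 0) {p : ℝ}
    (hp0 : 0 < p) (hp1 : p < 1) (x₀ : Plane) {R : ℝ} (hR : 0 < R) :
    ∃ s : ℝ, 0 < s ∧ ∀ u : Plane → ℝ, ContDiff ℝ 2 u →
      (∀ x ∈ ball x₀ R, 1 ≤ quadHess α β γ u x) → s ≤ ∫ x in ball x₀ R, |u x| ^ p := by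
  obtain ⟨v, w, hvw⟩ := quadHess_eq_of_nonelliptic h
  -- Small enough that parallelograms based in the half ball stay in the full ball.
  obtain ⟨t, ht, htR⟩ : ∃ t : ℝ, 0 < t ∧ t * (‖v‖ + ‖w‖) < R / 2 := by
    refine ⟨R / (4 * (‖v‖ + ‖w‖ + 1)), by positivity, ?_⟩
    rw [div_mul_eq_mul_div, div_lt_div_iff₀ (by positivity) (by norm_num)]
    nlinarith [norm_nonneg v, norm_nonneg w]
  have hmem : ∀ x ∈ ball x₀ (R / 2), ∀ r ∈ Icc 0 t, ∀ s ∈ Icc 0 t,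
      x + r • v + s • w ∈ ball x₀ R := by
    intro x hx r hr s hs
    rw [mem_ball_iff_norm] at hx ⊢
    have h1 : ‖r • v‖ ≤ t * ‖v‖ := by
      rw [norm_smul, Real.norm_of_nonneg hr.1]
      exact mul_le_mul_of_nonneg_right hr.2 (norm_nonneg _)
    have h2 : ‖s • w‖ ≤ t * ‖w‖ := by
      rw [norm_smul, Real.norm_of_nonneg hs.1]
      exact mul_le_mul_of_nonneg_right hs.2 (norm_nonneg _)
    calc ‖x + r • v + s • w - x₀‖ = ‖(x - x₀) + r • v + s • w‖ := by congr 1; abel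
      _ ≤ ‖x - x₀‖ + ‖r • v‖ + ‖s • w‖ := norm_add₃_le
      _ < R := by linarith
  have hV : 0 < volume.real (ball x₀ (R / 2)) :=
    ENNReal.toReal_pos (measure_ball_pos _ _ (by positivity)).ne' measure_ball_lt_top.ne
  -- The 4 counts the corners, each contributing at most I after translation.
  refine ⟨(t ^ 2) ^ p * volume.real (ball x₀ (R / 2)) / 4, by positivity, fun u hu hD => ?_⟩
  set I := ∫ x in ball x₀ R, |u x| ^ p
  have hc := hu.continuous.abs_rpow hp0
  have hshift : ∀ r ∈ Icc 0 t, ∀ s ∈ Icc 0 t,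
      ∫ x in ball x₀ (R / 2), |u (x + r • v + s • w)| ^ p ≤ I := by
    intro r hr s hs
    have e : ∀ y : Plane, r • v + s • w + (1 : ℝ) • y = y + r • v + s • w := fun y => by
      rw [one_smul]
      abel
    have := setIntegral_comp_add_smul_le hc (fun y => by positivity) measurableSet_ball
      measurableSet_ball isBounded_ball (x := r • v + s • w) one_pos
      (A := ball x₀ (R / 2)) (B := ball x₀ R)
      fun y hy => by simpa only [e] using hmem y hy r hr s hs
    simpa only [e, one_pow, inv_one, one_mul] using this
  have hint : ∀ r s : ℝ, IntegrableOn (fun x => |u (x + r • v + s • w)| ^ p)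
      (ball x₀ (R / 2)) := fun r s =>
    (hc.comp (by fun_prop : Continuous fun x : Plane => x + r • v + s • w)).integrableOn_ball _ _
  have hpt : ∀ x ∈ ball x₀ (R / 2), (t ^ 2) ^ p ≤ |u (x + t • v + t • w)| ^ p
      + |u (x + t • v + (0 : ℝ) • w)| ^ p + |u (x + (0 : ℝ) • v + t • w)| ^ p
      + |u (x + (0 : ℝ) • v + (0 : ℝ) • w)| ^ p := by
    intro x hx
    have h1 := hu.le_second_difference (x := x) (v := v) (w := w) ht fun r hr s hs => by
      rw [← hvw u hu]
      exact hD _ (hmem x hx r hr s hs)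
    simp only [zero_smul, add_zero]
    calc (t ^ 2) ^ p
        ≤ |u (x + t • v + t • w) + -u (x + t • v) + -u (x + t • w) + u x| ^ p := by
          refine Real.rpow_le_rpow (by positivity) (le_trans ?_ (le_abs_self _)) hp0.le
          linarith
      _ ≤ _ := by
          have e1 := abs_add_rpow_le hp0 hp1
            (u (x + t • v + t • w) + -u (x + t • v) + -u (x + t • w)) (u x)
          have e2 := abs_add_rpow_le hp0 hp1
            (u (x + t • v + t • w) + -u (x + t • v)) (-u (x + t • w))
          have e3 := abs_add_rpow_le hp0 hp1 (u (x + t • v + t • w)) (-u (x + t • v))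
          rw [abs_neg] at e2 e3
          linarith
  have h0 : (0 : ℝ) ∈ Icc 0 t := ⟨le_rfl, ht.le⟩
  have h1 : t ∈ Icc 0 t := ⟨ht.le, le_rfl⟩
  have hfin := setIntegral_mono_on (integrableOn_const (C := (t ^ 2) ^ p)
      (hs := (measure_ball_lt_top (x := x₀) (r := R / 2)).ne))
    ((((hint t t).add (hint t 0)).add (hint 0 t)).add (hint 0 0)) measurableSet_ball hpt
  rw [integral_add' (((hint t t).add (hint t 0)).add (hint 0 t)) (hint 0 0),
    integral_add' ((hint t t).add (hint t 0)) (hint 0 t), integral_add' (hint t t) (hint t 0),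
    setIntegral_const, smul_eq_mul] at hfin
  linarith [hshift t h1 t h1, hshift t h1 0 h0, hshift 0 h0 t h1, hshift 0 h0 0 h0]

/-! ### Calculus for the elliptic case -/

theorem hasDerivAt_max_zero_sq (t : ℝ) :
    HasDerivAt (fun t : ℝ => (max t 0) ^ 2) (2 * max t 0) t := by
  rcases lt_trichotomy t 0 with ht | rfl | ht
  · rw [max_eq_right ht.le, mul_zero]
    refine (hasDerivAt_const t (0 : ℝ)).congr_of_eventuallyEq ?_
    filter_upwards [Iio_mem_nhds ht] with s hs
    simp [max_eq_right (le_of_lt (mem_Iio.1 hs))]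
  · rw [hasDerivAt_iff_isLittleO]
    have h : (fun t : ℝ => (max t 0) ^ 2) =O[𝓝 0] fun t : ℝ => t ^ 2 :=
      Asymptotics.IsBigO.of_bound 1 (Eventually.of_forall fun t => by
        rw [one_mul, norm_pow, norm_pow]
        refine pow_le_pow_left₀ (norm_nonneg _) ?_ 2
        rcases le_total t 0 with h | h <;> simp [h])
    simpa using h.trans_isLittleO (Asymptotics.isLittleO_pow_id one_lt_two)
  · rw [max_eq_left ht.le]
    have h : HasDerivAt (fun t : ℝ => t ^ 2) (2 * t) t := by simpa using hasDerivAt_pow 2 t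
    refine h.congr_of_eventuallyEq ?_
    filter_upwards [Ioi_mem_nhds ht] with s hs
    simp [max_eq_left (le_of_lt (mem_Ioi.1 hs))]

theorem integral_fderiv_mul_fderiv {u ψ : Plane → ℝ} (hu : ContDiff ℝ 2 u)
    (hψ : ContDiff ℝ 1 ψ) (hψc : HasCompactSupport ψ) (x : Plane) (t : ℝ) (e v : Plane) :
    ∫ y, fderiv ℝ u (x + t • y) e * fderiv ℝ ψ y v =
      -(t * ∫ y, fderiv ℝ (fderiv ℝ u) (x + t • y) v e * ψ y) := by
  have hf : ∀ y, HasFDerivAt (fun y => fderiv ℝ u (x + t • y) e)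
      ((t • fderiv ℝ (fderiv ℝ u) (x + t • y)).flip e) y := fun y => by
    have h1 : HasFDerivAt (fun y : Plane => x + t • y) (t • ContinuousLinearMap.id ℝ Plane) y :=
      ((hasFDerivAt_id y).const_smul t).const_add x
    have h2 := ((hu.differentiable_fderiv (x + t • y)).hasFDerivAt.comp y h1).clm_apply
      (hasFDerivAt_const e y)
    refine h2.congr_fderiv ?_
    ext z
    simp
  have hH : Continuous fun y => fderiv ℝ (fderiv ℝ u) (x + t • y) :=
    hu.continuous_fderiv_fderiv.comp (by fun_prop)
  have hf' : Continuous fun y => fderiv ℝ u (x + t • y) e :=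
    continuous_iff_continuousAt.2 fun y => (hf y).continuousAt
  have hψ' : Continuous fun y => fderiv ℝ ψ y v :=
    (hψ.continuous_fderiv (by norm_num)).clm_apply continuous_const
  rw [integral_mul_fderiv_eq_neg_fderiv_mul_of_integrable, ← integral_const_mul]
  · simp only [fun y => (hf y).fderiv]
    simp [mul_assoc]
  · simp only [fun y => (hf y).fderiv]
    refine Continuous.integrable_of_hasCompactSupport ?_ hψc.mul_left
    refine Continuous.mul ?_ hψ.continuous
    exact ((continuous_const_smul t).comp
      ((hH.clm_apply continuous_const).clm_apply continuous_const) :)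
  · exact (hf'.mul hψ').integrable_of_hasCompactSupport (hψc.fderiv_apply (𝕜 := ℝ) v).mul_left
  · exact (hf'.mul hψ.continuous).integrable_of_hasCompactSupport hψc.mul_left
  · exact fun y _ => (hf y).differentiableAt
  · exact fun y _ => hψ.differentiable (by norm_num) y

theorem hasDerivAt_integral_mul_comp_smul {u w : Plane → ℝ} (hu : ContDiff ℝ 1 u)
    (hw : Continuous w) (hw1 : ∀ y, 1 < ‖y‖ → w y = 0) (x : Plane) (t : ℝ) :
    HasDerivAt (fun t : ℝ => ∫ y, w y * u (x + t • y))
      (∫ y, w y * fderiv ℝ u (x + t • y) y) t := by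
  have hwc : HasCompactSupport w := HasCompactSupport.intro (isCompact_closedBall (0 : Plane) 1)
    fun y hy => hw1 y (by simpa using hy)
  have hu' : Continuous (fderiv ℝ u) := hu.continuous_fderiv (by norm_num)
  have hF' : Continuous fun z : ℝ × Plane => w z.2 * fderiv ℝ u (x + z.1 • z.2) z.2 :=
    (hw.comp continuous_snd).mul ((hu'.comp (by fun_prop)).clm_apply continuous_snd)
  obtain ⟨C, hC⟩ := ((isCompact_closedBall t 1).prod
    (isCompact_closedBall (0 : Plane) 1)).exists_bound_of_continuousOn hF'.continuousOn
  refine (hasDerivAt_integral_of_dominated_loc_of_deriv_le (closedBall_mem_nhds t one_pos)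
    (F' := fun t y => w y * fderiv ℝ u (x + t • y) y)
    (bound := (closedBall (0 : Plane) 1).indicator fun _ => C)
    (Eventually.of_forall fun s => ?_) ?_ ?_ (ae_of_all _ fun y s hs => ?_) ?_
    (ae_of_all _ fun y s _ => ?_)).2
  · exact (hw.mul (hu.continuous.comp (by fun_prop))).aestronglyMeasurable
  · exact (hw.mul (hu.continuous.comp (by fun_prop))).integrable_of_hasCompactSupport hwc.mul_right
  · exact (hF'.comp (Continuous.prodMk continuous_const continuous_id)).aestronglyMeasurable
  · by_cases hy : y ∈ closedBall (0 : Plane) 1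
    · rw [indicator_of_mem hy]
      exact hC (s, y) ⟨hs, hy⟩
    · rw [indicator_of_notMem hy, hw1 y (by simpa using hy)]
      simp
  · exact (integrable_indicator_iff measurableSet_closedBall).2
      (integrableOn_const (hs := measure_closedBall_lt_top.ne))
  · have hline : HasDerivAt (fun s : ℝ => x + s • y) y s := by
      simpa using ((hasDerivAt_id s).smul_const y).const_add x
    exact (((hu.differentiable (by norm_num)) _).hasFDerivAt.comp_hasDerivAt s hline).const_mul _

/-! ### The weight and bump adapted to a positive definite matrix -/

/-- A multiple of the quadratic form of the inverse of the matrix `!![α, β; β, γ]`. -/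
noncomputable def invForm (α β γ : ℝ) (y : Plane) : ℝ :=
  (α + γ) / (α * γ - β ^ 2) * (γ * y 0 ^ 2 - 2 * β * (y 0 * y 1) + α * y 1 ^ 2)

/-- A bump function supported in the unit ball, adapted to the matrix `!![α, β; β, γ]`. -/
noncomputable def formBump (α β γ : ℝ) (y : Plane) : ℝ := (max (1 - invForm α β γ y) 0) ^ 2

/-- The nonnegative weight `w` with `A ∇ψ = -2 (tr A) w(y) y`, where `ψ = formBump α β γ`. -/
noncomputable def formWeight (α β γ : ℝ) (y : Plane) : ℝ := 2 * max (1 - invForm α β γ y) 0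

theorem continuous_invForm (α β γ : ℝ) : Continuous (invForm α β γ) := by
  unfold invForm
  fun_prop

theorem continuous_formWeight (α β γ : ℝ) : Continuous (formWeight α β γ) :=
  continuous_const.mul ((continuous_const.sub (continuous_invForm α β γ)).max continuous_const)

theorem formWeight_nonneg (α β γ : ℝ) (y : Plane) : 0 ≤ formWeight α β γ y :=
  mul_nonneg zero_le_two (le_max_right _ _)

/-- With B the adjugate of A, Cayley–Hamilton gives tr(A)·yᵀBy = |By|² + det(A)|y|². The factor tr A
in `invForm` thus places the supports of bump and weight in the unit ball. -/
theorem norm_sq_le_invForm {α β γ : ℝ} (hd : 0 < α * γ - β ^ 2) (y : Plane) :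
    ‖y‖ ^ 2 ≤ invForm α β γ y := by
  rw [EuclideanSpace.norm_sq_eq, Fin.sum_univ_two, invForm, div_mul_eq_mul_div, le_div_iff₀ hd]
  simp only [Real.norm_eq_abs, sq_abs]
  nlinarith [sq_nonneg (γ * y 0 - β * y 1), sq_nonneg (β * y 0 - α * y 1)]

theorem formWeight_le_two {α β γ : ℝ} (hd : 0 < α * γ - β ^ 2) (y : Plane) :
    formWeight α β γ y ≤ 2 := by
  have := norm_sq_le_invForm hd y
  have : max (1 - invForm α β γ y) 0 ≤ 1 := max_le (by nlinarith [sq_nonneg ‖y‖]) zero_le_one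
  rw [formWeight]
  linarith

theorem max_one_sub_invForm_eq_zero {α β γ : ℝ} (hd : 0 < α * γ - β ^ 2) {y : Plane}
    (hy : 1 < ‖y‖) : max (1 - invForm α β γ y) 0 = 0 := by
  have := norm_sq_le_invForm hd y
  exact max_eq_right (by nlinarith)

theorem formWeight_eq_zero {α β γ : ℝ} (hd : 0 < α * γ - β ^ 2) {y : Plane} (hy : 1 < ‖y‖) :
    formWeight α β γ y = 0 := by
  rw [formWeight, max_one_sub_invForm_eq_zero hd hy, mul_zero]

theorem formBump_eq_zero {α β γ : ℝ} (hd : 0 < α * γ - β ^ 2) {y : Plane} (hy : 1 < ‖y‖) :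
    formBump α β γ y = 0 := by
  rw [formBump, max_one_sub_invForm_eq_zero hd hy]
  simp

theorem hasCompactSupport_of_norm {f : Plane → ℝ} (hf : ∀ y, 1 < ‖y‖ → f y = 0) :
    HasCompactSupport f :=
  HasCompactSupport.intro (isCompact_closedBall (0 : Plane) 1) fun y hy => hf y (by simpa using hy)

theorem hasFDerivAt_formBump (α β γ : ℝ) (y : Plane) :
    HasFDerivAt (formBump α β γ) (-(formWeight α β γ y * ((α + γ) / (α * γ - β ^ 2))) •
      ((2 * (γ * y 0 - β * y 1)) • (EuclideanSpace.proj (0 : Fin 2) : Plane →L[ℝ] ℝ)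
      + (2 * (α * y 1 - β * y 0)) • (EuclideanSpace.proj (1 : Fin 2) : Plane →L[ℝ] ℝ))) y := by
  have h0 := (EuclideanSpace.proj (0 : Fin 2) : Plane →L[ℝ] ℝ).hasFDerivAt (x := y)
  have h1 := (EuclideanSpace.proj (1 : Fin 2) : Plane →L[ℝ] ℝ).hasFDerivAt (x := y)
  have hq := ((((h0.pow 2).const_mul γ).sub ((h0.mul h1).const_mul (2 * β))).add
    ((h1.pow 2).const_mul α)).const_mul ((α + γ) / (α * γ - β ^ 2))
  have h := (hasDerivAt_max_zero_sq (1 - invForm α β γ y)).comp_hasFDerivAt y (hq.const_sub 1)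
  refine h.congr_fderiv ?_
  ext z
  simp [formWeight]
  ring

theorem contDiff_formBump (α β γ : ℝ) : ContDiff ℝ 1 (formBump α β γ) := by
  rw [contDiff_one_iff_fderiv]
  refine ⟨fun y => (hasFDerivAt_formBump α β γ y).differentiableAt, ?_⟩
  have := continuous_formWeight α β γ
  rw [show fderiv ℝ (formBump α β γ) = _ from funext fun y => (hasFDerivAt_formBump α β γ y).fderiv]
  fun_prop

theorem integral_pos_of_apply_zero {f : Plane → ℝ} (hf : Continuous f) (hf0 : ∀ y, 0 ≤ f y)
    (hf1 : ∀ y, 1 < ‖y‖ → f y = 0) (h : f 0 ≠ 0) : 0 < ∫ y, f y :=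
  hf.integral_pos_of_hasCompactSupport_nonneg_nonzero (hasCompactSupport_of_norm hf1) hf0 h

theorem integral_linear_combination {f₁ f₂ f₃ f₄ : Plane → ℝ} (h₁ : Integrable f₁)
    (h₂ : Integrable f₂) (h₃ : Integrable f₃) (h₄ : Integrable f₄) (a b c d : ℝ) :
    ∫ y, (a * f₁ y + b * f₂ y + c * f₃ y + d * f₄ y) =
      a * (∫ y, f₁ y) + b * (∫ y, f₂ y) + c * (∫ y, f₃ y) + d * ∫ y, f₄ y := by
  rw [integral_add, integral_add, integral_add]
  · simp only [integral_const_mul]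
  all_goals fun_prop

/-! ### The weighted mean value inequality -/

/-- Since w(y)y = -A∇ψ/(2 tr A), integration by parts moves the derivative from ψ onto ∇u and
produces Du; the chain rule supplies the factor t. -/
theorem integral_formWeight_mul_fderiv {α β γ : ℝ} (hτ : 0 < α + γ) (hd : 0 < α * γ - β ^ 2)
    {u : Plane → ℝ} (hu : ContDiff ℝ 2 u) (x : Plane) (t : ℝ) :
    ∫ y, formWeight α β γ y * fderiv ℝ u (x + t • y) y =
      t / (2 * (α + γ)) * ∫ y, quadHess α β γ u (x + t • y) * formBump α β γ y := by
  set ψ := formBump α β γ with hψdef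
  have hψ : ContDiff ℝ 1 ψ := contDiff_formBump α β γ
  have hψc : HasCompactSupport ψ := hasCompactSupport_of_norm fun y => formBump_eq_zero hd
  set e : Fin 2 → Plane := fun i => EuclideanSpace.single i (1 : ℝ)
  have hu' : Continuous fun y => fderiv ℝ u (x + t • y) :=
    (hu.continuous_fderiv (by norm_num)).comp (by fun_prop)
  have hH : Continuous fun y => fderiv ℝ (fderiv ℝ u) (x + t • y) :=
    hu.continuous_fderiv_fderiv.comp (by fun_prop)
  have hi1 : ∀ i j : Fin 2,
      Integrable fun y => fderiv ℝ u (x + t • y) (e i) * fderiv ℝ ψ y (e j) := fun i j =>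
    ((hu'.clm_apply continuous_const).mul ((hψ.continuous_fderiv (by norm_num)).clm_apply
      continuous_const)).integrable_of_hasCompactSupport (hψc.fderiv_apply (𝕜 := ℝ) (e j)).mul_left
  have hi2 : ∀ i j : Fin 2,
      Integrable fun y => fderiv ℝ (fderiv ℝ u) (x + t • y) (e i) (e j) * ψ y := fun i j =>
    (((hH.clm_apply continuous_const).clm_apply continuous_const).mul
      hψ.continuous).integrable_of_hasCompactSupport hψc.mul_left
  have hibp := fun i j : Fin 2 => integral_fderiv_mul_fderiv hu hψ hψc x t (e i) (e j)
  have hl : ∀ y, formWeight α β γ y * fderiv ℝ u (x + t • y) y = -(2 * (α + γ))⁻¹ *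
      (α * (fderiv ℝ u (x + t • y) (e 0) * fderiv ℝ ψ y (e 0))
        + β * (fderiv ℝ u (x + t • y) (e 0) * fderiv ℝ ψ y (e 1))
        + β * (fderiv ℝ u (x + t • y) (e 1) * fderiv ℝ ψ y (e 0))
        + γ * (fderiv ℝ u (x + t • y) (e 1) * fderiv ℝ ψ y (e 1))) := by
    intro y
    have hy : fderiv ℝ u (x + t • y) y =
        y 0 * fderiv ℝ u (x + t • y) (e 0) + y 1 * fderiv ℝ u (x + t • y) (e 1) := by
      generalize fderiv ℝ u (x + t • y) = L
      conv_lhs => rw [plane_eq_single_add_single y]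
      simp [e]
    have h0 : fderiv ℝ ψ y (e 0) = -(formWeight α β γ y * ((α + γ) / (α * γ - β ^ 2))) *
        (2 * (γ * y 0 - β * y 1)) := by
      rw [(hasFDerivAt_formBump α β γ y).fderiv]
      simp [e]
    have h1 : fderiv ℝ ψ y (e 1) = -(formWeight α β γ y * ((α + γ) / (α * γ - β ^ 2))) *
        (2 * (α * y 1 - β * y 0)) := by
      rw [(hasFDerivAt_formBump α β γ y).fderiv]
      simp [e]
    rw [hy, h0, h1]
    have := hd.ne'
    field_simp
    ring
  have hr : ∀ y, quadHess α β γ u (x + t • y) * ψ y =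
      α * (fderiv ℝ (fderiv ℝ u) (x + t • y) (e 0) (e 0) * ψ y)
      + β * (fderiv ℝ (fderiv ℝ u) (x + t • y) (e 1) (e 0) * ψ y)
      + β * (fderiv ℝ (fderiv ℝ u) (x + t • y) (e 0) (e 1) * ψ y)
      + γ * (fderiv ℝ (fderiv ℝ u) (x + t • y) (e 1) (e 1) * ψ y) := by
    intro y
    rw [hu.fderiv_fderiv_comm _ (e 1) (e 0), quadHess]
    ring
  simp only [hl, hr]
  rw [integral_const_mul, integral_linear_combination (hi1 0 0) (hi1 0 1) (hi1 1 0) (hi1 1 1),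
    integral_linear_combination (hi2 0 0) (hi2 1 0) (hi2 0 1) (hi2 1 1)]
  simp only [hibp]
  field_simp
  ring

/-- The derivative in t of ∫ w(y) u(x + ty) dy is t/(2 tr A) ∫ (Du)(x + ty) ψ(y) dy ≥ 2κt, so the
integral minus κt² is monotone; compare t = 0 with t = ρ. -/
theorem mul_add_le_integral_formWeight_mul {α β γ : ℝ} (hτ : 0 < α + γ)
    (hd : 0 < α * γ - β ^ 2) {u : Plane → ℝ} (hu : ContDiff ℝ 2 u) {x : Plane} {ρ : ℝ}
    (hρ : 0 < ρ) (h : ∀ z ∈ ball x ρ, 1 ≤ quadHess α β γ u z) :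
    (∫ y, formWeight α β γ y) * u x + (∫ y, formBump α β γ y) / (4 * (α + γ)) * ρ ^ 2 ≤
      ∫ y, formWeight α β γ y * u (x + ρ • y) := by
  set κ := (∫ y, formBump α β γ y) / (4 * (α + γ)) with hκ
  have hF := hasDerivAt_integral_mul_comp_smul (hu.of_le (by norm_num))
    (continuous_formWeight α β γ) (fun y => formWeight_eq_zero hd) x
  have hG : ∀ t, HasDerivAt (fun t => (∫ y, formWeight α β γ y * u (x + t • y)) - κ * t ^ 2)
      ((∫ y, formWeight α β γ y * fderiv ℝ u (x + t • y) y) - κ * (2 * t)) t := fun t => by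
    refine HasDerivAt.congr_deriv ((hF t).sub ((hasDerivAt_pow 2 t).const_mul κ)) ?_
    simp
  have hmono : MonotoneOn (fun t => (∫ y, formWeight α β γ y * u (x + t • y)) - κ * t ^ 2)
      (Icc 0 ρ) := by
    refine monotoneOn_of_deriv_nonneg (convex_Icc 0 ρ)
      (fun t _ => (hG t).continuousAt.continuousWithinAt)
      (fun t _ => (hG t).differentiableAt.differentiableWithinAt) fun t ht => ?_
    rw [interior_Icc] at ht
    have hψ := (contDiff_formBump α β γ).continuous
    have hψc : HasCompactSupport (formBump α β γ) :=
      hasCompactSupport_of_norm fun y => formBump_eq_zero hd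
    have hQ : Continuous fun y => quadHess α β γ u (x + t • y) := by
      have hH : Continuous fun y => fderiv ℝ (fderiv ℝ u) (x + t • y) :=
        hu.continuous_fderiv_fderiv.comp (by fun_prop)
      unfold quadHess
      fun_prop
    have hle : ∫ y, formBump α β γ y ≤
        ∫ y, quadHess α β γ u (x + t • y) * formBump α β γ y := by
      refine integral_mono (hψ.integrable_of_hasCompactSupport hψc)
        ((hQ.mul hψ).integrable_of_hasCompactSupport hψc.mul_left) fun y => ?_
      rcases lt_or_ge 1 ‖y‖ with hy | hy
      · simp [formBump_eq_zero hd hy]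
      · refine le_mul_of_one_le_left (sq_nonneg _) (h _ ?_)
        rw [mem_ball_iff_norm, add_sub_cancel_left, norm_smul, Real.norm_of_nonneg ht.1.le]
        nlinarith [ht.1, ht.2]
    rw [(hG t).deriv, integral_formWeight_mul_fderiv hτ hd hu, sub_nonneg]
    calc κ * (2 * t) = t / (2 * (α + γ)) * ∫ y, formBump α β γ y := by
          rw [hκ]
          field_simp
          ring
      _ ≤ _ := mul_le_mul_of_nonneg_left hle (div_nonneg ht.1.le (by linarith))
  have := hmono ⟨le_rfl, hρ.le⟩ ⟨hρ.le, le_rfl⟩ hρ.le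
  simp only [zero_smul, add_zero, integral_mul_const] at this
  linarith

/-! ### Interior bounds for p < 1 and the elliptic estimate -/

theorem le_rpow_mul_abs_rpow {a N p : ℝ} (hp1 : p < 1) (hN : 0 ≤ N) (haN : a ≤ N) :
    a ≤ N ^ (1 - p) * |a| ^ p := by
  rcases le_or_gt a 0 with ha | ha
  · exact ha.trans (by positivity)
  · rw [abs_of_pos ha]
    calc a = a ^ (1 - p) * a ^ p := by rw [← Real.rpow_add ha, sub_add_cancel, Real.rpow_one]
      _ ≤ _ := mul_le_mul_of_nonneg_right (Real.rpow_le_rpow ha.le haN (by linarith))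
          (by positivity)

theorem integral_formWeight_pos {α β γ : ℝ} (hd : 0 < α * γ - β ^ 2) :
    0 < ∫ y, formWeight α β γ y :=
  integral_pos_of_apply_zero (continuous_formWeight α β γ) (formWeight_nonneg α β γ)
    (fun _ => formWeight_eq_zero hd) (by simp [formWeight, invForm])

theorem integral_formBump_pos {α β γ : ℝ} (hd : 0 < α * γ - β ^ 2) :
    0 < ∫ y, formBump α β γ y :=
  integral_pos_of_apply_zero (contDiff_formBump α β γ).continuous (fun _ => sq_nonneg _)
    (fun _ => formBump_eq_zero hd) (by simp [formBump, invForm])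

theorem integrable_formWeight_mul {α β γ : ℝ} (hd : 0 < α * γ - β ^ 2) {f : Plane → ℝ}
    (hf : Continuous f) : Integrable fun y => formWeight α β γ y * f y :=
  ((continuous_formWeight α β γ).mul hf).integrable_of_hasCompactSupport
    (hasCompactSupport_of_norm fun _ => formWeight_eq_zero hd).mul_right

theorem integral_formWeight_mul_le {α β γ : ℝ} (hd : 0 < α * γ - β ^ 2) {p : ℝ} (hp0 : 0 < p)
    (hp1 : p < 1) {u : Plane → ℝ} (hu : Continuous u) {x₀ x : Plane} {R ρ N : ℝ} (hρ : 0 < ρ)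
    (hN : 0 ≤ N) (hball : ∀ y : Plane, ‖y‖ ≤ 1 → x + ρ • y ∈ ball x₀ R)
    (hle : ∀ y : Plane, ‖y‖ ≤ 1 → u (x + ρ • y) ≤ N) :
    ∫ y, formWeight α β γ y * u (x + ρ • y) ≤
      2 * N ^ (1 - p) * ((ρ ^ 2)⁻¹ * ∫ z in ball x₀ R, |u z| ^ p) := by
  have hc := hu.abs_rpow hp0
  have hcx : Continuous fun y : Plane => |u (x + ρ • y)| ^ p := hc.comp (by fun_prop)
  calc ∫ y, formWeight α β γ y * u (x + ρ • y)
      ≤ ∫ y, (closedBall (0 : Plane) 1).indicator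
          (fun y => 2 * N ^ (1 - p) * |u (x + ρ • y)| ^ p) y := by
        refine integral_mono (integrable_formWeight_mul hd (hu.comp (by fun_prop)))
          ((integrable_indicator_iff measurableSet_closedBall).2
            ((continuous_const.mul hcx).continuousOn.integrableOn_compact
              (isCompact_closedBall 0 1))) fun y => ?_
        rcases lt_or_ge 1 ‖y‖ with hy | hy
        · rw [indicator_of_notMem (by simpa using hy)]
          simp [formWeight_eq_zero hd hy]
        · rw [indicator_of_mem (by simpa using hy), mul_assoc]
          refine (mul_le_mul_of_nonneg_left (le_rpow_mul_abs_rpow hp1 hN (hle y hy))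
            (formWeight_nonneg α β γ y)).trans ?_
          exact mul_le_mul_of_nonneg_right (formWeight_le_two hd y) (by positivity)
    _ = 2 * N ^ (1 - p) * ∫ y in closedBall 0 1, |u (x + ρ • y)| ^ p := by
        rw [integral_indicator measurableSet_closedBall, integral_const_mul]
    _ ≤ _ := mul_le_mul_of_nonneg_left (setIntegral_comp_add_smul_le hc (fun y => by positivity)
        measurableSet_closedBall measurableSet_ball isBounded_ball hρ
        fun y hy => hball y (by simpa using hy)) (by positivity)

/-- Maximize u⁺ weighted by a power of the distance to the boundary. Near a maximum point m, u is
controlled by the maximum M itself, so the mean value inequality with u ≤ N^(1-p)|u|^p bounds M by a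
multiple of M^(1-p)∫|u|^p, and M^(1-p) is absorbed. The exponent 2/p makes the powers of ρ cancel in
dimension two. -/
theorem rpow_mul_max_le {α β γ : ℝ} (hτ : 0 < α + γ) (hd : 0 < α * γ - β ^ 2) {p : ℝ}
    (hp0 : 0 < p) (hp1 : p < 1) {x₀ : Plane} {R : ℝ} {u : Plane → ℝ}
    (hu : ContDiff ℝ 2 u) (h : ∀ z ∈ ball x₀ R, 1 ≤ quadHess α β γ u z) {x : Plane}
    (hx : x ∈ closedBall x₀ R) :
    (R - dist x x₀) ^ (2 / p) * max (u x) 0 ≤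
      (2 * 2 ^ (2 / p) / (∫ y, formWeight α β γ y) * ∫ z in ball x₀ R, |u z| ^ p) ^ (1 / p) := by
  set k := 2 / p with hk
  have hk0 : 0 < k := by positivity
  set W := ∫ y, formWeight α β γ y with hWdef
  have hW : 0 < W := integral_formWeight_pos hd
  set I := ∫ z in ball x₀ R, |u z| ^ p with hI
  have hI0 : 0 ≤ I := integral_nonneg fun z => by positivity
  set g : Plane → ℝ := fun x => (R - dist x x₀) ^ k * max (u x) 0 with hg
  have hgc : Continuous g := ((continuous_const.sub (by fun_prop)).rpow_const
    fun _ => Or.inr hk0.le).mul (hu.continuous.max continuous_const)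
  obtain ⟨m, hm, hmax⟩ := (isCompact_closedBall x₀ R).exists_isMaxOn ⟨x, hx⟩ hgc.continuousOn
  refine (hmax hx : g x ≤ g m).trans ?_
  rcases le_or_gt (g m) 0 with hM | hM
  · exact hM.trans (by positivity)
  have hdm : 0 < R - dist m x₀ := by
    refine lt_of_le_of_ne (sub_nonneg.2 hm) fun h0 => ?_
    rw [hg] at hM
    simp [← h0, Real.zero_rpow hk0.ne'] at hM
  have hum : 0 < u m := by
    by_contra! h0
    rw [hg] at hM
    simp [max_eq_right h0] at hM
  -- With half the distance to the boundary as radius, points of the ball about m are still at least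
  -- ρ from the boundary.
  obtain ⟨ρ, hρd⟩ : ∃ ρ, R - dist m x₀ = 2 * ρ := ⟨(R - dist m x₀) / 2, by ring⟩
  have hρ : 0 < ρ := by linarith
  set T := ρ ^ k with hT
  have hT0 : 0 < T := by positivity
  have hTp : T ^ p = ρ ^ 2 := by
    rw [hT, ← Real.rpow_mul hρ.le, hk, div_mul_cancel₀ _ hp0.ne']
    norm_cast
  have hMeq : g m = 2 ^ k * T * u m := by
    simp only [hg]
    rw [hρd, max_eq_left hum.le, Real.mul_rpow zero_le_two hρ.le]
  set M := g m
  have hdist : ∀ y : Plane, ‖y‖ ≤ 1 → dist (m + ρ • y) x₀ ≤ R - ρ := by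
    intro y hy
    have h1 : dist (m + ρ • y) m ≤ ρ := by
      rw [dist_eq_norm, add_sub_cancel_left, norm_smul, Real.norm_of_nonneg hρ.le]
      nlinarith
    linarith [dist_triangle (m + ρ • y) m x₀]
  have hub : ∀ y : Plane, ‖y‖ ≤ 1 → u (m + ρ • y) ≤ M / T := by
    intro y hy
    rw [le_div_iff₀ hT0]
    have hy' := hdist y hy
    have h1 : g (m + ρ • y) ≤ M := hmax (show m + ρ • y ∈ closedBall x₀ R by
      rw [mem_closedBall]
      linarith)
    have h2 : T ≤ (R - dist (m + ρ • y) x₀) ^ k :=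
      Real.rpow_le_rpow hρ.le (by linarith) hk0.le
    calc u (m + ρ • y) * T ≤ max (u (m + ρ • y)) 0 * T :=
          mul_le_mul_of_nonneg_right (le_max_left _ _) hT0.le
      _ ≤ max (u (m + ρ • y)) 0 * (R - dist (m + ρ • y) x₀) ^ k :=
          mul_le_mul_of_nonneg_left h2 (le_max_right _ _)
      _ ≤ M := by rwa [mul_comm]
  have hmean := mul_add_le_integral_formWeight_mul hτ hd hu (x := m) hρ fun z hz => h z (by
    rw [mem_ball] at hz ⊢
    linarith [dist_triangle z m x₀])
  have hκ : 0 ≤ (∫ y, formBump α β γ y) / (4 * (α + γ)) * ρ ^ 2 := by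
    have := integral_formBump_pos hd
    positivity
  have hup := integral_formWeight_mul_le hd hp0 hp1 hu.continuous (x₀ := x₀) (R := R) hρ
    (div_pos hM hT0).le (fun y hy => by
      rw [mem_ball]
      linarith [hdist y hy]) hub
  have hN : (M / T) ^ (1 - p) = M / T * (ρ ^ 2 / M ^ p) := by
    rw [Real.rpow_sub (div_pos hM hT0), Real.rpow_one, Real.div_rpow hM.le hT0.le, hTp]
    field_simp
  have hMp : 0 < M ^ p := by positivity
  -- The gain κρ² is only needed to be nonnegative here.
  have hfin : W * u m ≤ 2 * (M / T * (ρ ^ 2 / M ^ p)) * ((ρ ^ 2)⁻¹ * I) := by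
    rw [← hN]
    linarith
  rw [← Real.rpow_le_rpow_iff hM.le (by positivity) hp0, ← Real.rpow_mul (by positivity),
    one_div_mul_cancel hp0.ne', Real.rpow_one, div_mul_eq_mul_div, le_div_iff₀ hW]
  have e : 2 * (M / T * (ρ ^ 2 / M ^ p)) * ((ρ ^ 2)⁻¹ * I) = u m / M ^ p * (2 * 2 ^ k * I) := by
    rw [hMeq]
    field_simp
  rw [e, div_mul_eq_mul_div, le_div_iff₀ hMp] at hfin
  nlinarith

theorem exists_le_integral_of_elliptic {α β γ : ℝ} (hτ : 0 < α + γ) (hd : 0 < α * γ - β ^ 2)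
    {p : ℝ} (hp0 : 0 < p) (hp1 : p < 1) (x₀ : Plane) {R : ℝ} (hR : 0 < R) :
    ∃ s : ℝ, 0 < s ∧ ∀ u : Plane → ℝ, ContDiff ℝ 2 u →
      (∀ x ∈ ball x₀ R, 1 ≤ quadHess α β γ u x) → s ≤ ∫ x in ball x₀ R, |u x| ^ p := by
  set W := ∫ y, formWeight α β γ y with hWdef
  have hW : 0 < W := integral_formWeight_pos hd
  set κ := (∫ y, formBump α β γ y) / (4 * (α + γ)) with hκdef
  have hκ : 0 < κ := div_pos (integral_formBump_pos hd) (by linarith)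
  set C := 2 * 2 ^ (2 / p) / W with hC
  set V := volume.real (ball x₀ (R / 4))
  have hV : 0 < V :=
    ENNReal.toReal_pos (measure_ball_pos _ _ (by positivity)).ne' measure_ball_lt_top.ne
  set A := W * ((V⁻¹) ^ (1 / p) + C ^ (1 / p) / (R / 2) ^ (2 / p)) with hA
  refine ⟨(κ * (R / 4) ^ 2 / A) ^ p, by positivity, fun u hu h => ?_⟩
  set I := ∫ z in ball x₀ R, |u z| ^ p with hI
  have hI0 : 0 ≤ I := integral_nonneg fun z => by positivity
  have hc := hu.continuous.abs_rpow hp0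
  -- A point where |u|^p is at most its average: u(m) cannot be very negative.
  obtain ⟨m, hm, hmle⟩ := exists_le_setAverage
    (measure_ball_pos volume x₀ (show 0 < R / 4 by positivity)).ne' measure_ball_lt_top.ne
    (hc.integrableOn_ball x₀ (R / 4))
  rw [setAverage_eq, smul_eq_mul] at hmle
  have hum : |u m| ≤ (V⁻¹) ^ (1 / p) * I ^ (1 / p) := by
    rw [← Real.mul_rpow (by positivity) hI0, ← Real.rpow_le_rpow_iff (abs_nonneg _)
      (by positivity) hp0, ← Real.rpow_mul (by positivity), one_div_mul_cancel hp0.ne',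
      Real.rpow_one]
    refine hmle.trans (mul_le_mul_of_nonneg_left ?_ (by positivity))
    exact setIntegral_mono_set (hc.integrableOn_ball x₀ R) (ae_of_all _ fun z => by positivity)
      (ball_subset_ball (by linarith)).eventuallyLE
  have hdist : ∀ y : Plane, ‖y‖ ≤ 1 → dist (m + (R / 4) • y) x₀ ≤ R / 2 := by
    intro y hy
    have h1 : dist (m + (R / 4) • y) m ≤ R / 4 := by
      rw [dist_eq_norm, add_sub_cancel_left, norm_smul, Real.norm_of_nonneg (by positivity)]
      nlinarith
    linarith [dist_triangle (m + (R / 4) • y) m x₀, mem_ball.1 hm]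
  have hub : ∀ y : Plane, ‖y‖ ≤ 1 →
      u (m + (R / 4) • y) ≤ C ^ (1 / p) / (R / 2) ^ (2 / p) * I ^ (1 / p) := by
    intro y hy
    have hy' := hdist y hy
    have h1 := rpow_mul_max_le hτ hd hp0 hp1 hu h (x := m + (R / 4) • y) (by
      rw [mem_closedBall]
      linarith)
    rw [← hWdef, ← hC, ← hI, Real.mul_rpow (by positivity) hI0] at h1
    have h2 : (R / 2) ^ (2 / p) ≤ (R - dist (m + (R / 4) • y) x₀) ^ (2 / p) :=
      Real.rpow_le_rpow (by positivity) (by linarith) (by positivity)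
    rw [div_mul_eq_mul_div, le_div_iff₀ (by positivity)]
    calc u (m + (R / 4) • y) * (R / 2) ^ (2 / p)
        ≤ max (u (m + (R / 4) • y)) 0 * (R / 2) ^ (2 / p) :=
          mul_le_mul_of_nonneg_right (le_max_left _ _) (by positivity)
      _ ≤ max (u (m + (R / 4) • y)) 0 * (R - dist (m + (R / 4) • y) x₀) ^ (2 / p) :=
          mul_le_mul_of_nonneg_left h2 (le_max_right _ _)
      _ ≤ _ := by rwa [mul_comm]
  have hmean := mul_add_le_integral_formWeight_mul hτ hd hu (x := m) (ρ := R / 4)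
    (by positivity) fun z hz => h z (by
      rw [mem_ball] at hz hm ⊢
      linarith [dist_triangle z m x₀])
  have hup : ∫ y, formWeight α β γ y * u (m + (R / 4) • y) ≤
      W * (C ^ (1 / p) / (R / 2) ^ (2 / p) * I ^ (1 / p)) := by
    rw [hWdef, ← integral_mul_const]
    refine integral_mono (integrable_formWeight_mul hd (hu.continuous.comp (by fun_prop)))
      (integrable_formWeight_mul hd continuous_const) fun y => ?_
    rcases lt_or_ge 1 ‖y‖ with hy | hy
    · simp [formWeight_eq_zero hd hy]
    · exact mul_le_mul_of_nonneg_left (hub y hy) (formWeight_nonneg α β γ y)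
  have hA0 : 0 < A := by positivity
  -- Here the gain is essential: it is at most the upper bound for the weighted mean minus W u(m),
  -- and both are multiples of I^(1/p).
  have hfin : κ * (R / 4) ^ 2 / A ≤ I ^ (1 / p) := by
    rw [div_le_iff₀ hA0]
    have h1 : W * -u m ≤ W * ((V⁻¹) ^ (1 / p) * I ^ (1 / p)) :=
      mul_le_mul_of_nonneg_left ((neg_le_abs _).trans hum) hW.le
    calc κ * (R / 4) ^ 2 ≤ W * -u m + W * (C ^ (1 / p) / (R / 2) ^ (2 / p) * I ^ (1 / p)) := by
          linarith
      _ ≤ I ^ (1 / p) * A := by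
          rw [hA]
          linarith
  calc (κ * (R / 4) ^ 2 / A) ^ p ≤ (I ^ (1 / p)) ^ p :=
        Real.rpow_le_rpow (by positivity) hfin hp0.le
    _ = I := by rw [← Real.rpow_mul hI0, one_div_mul_cancel hp0.ne', Real.rpow_one]

/-! ### All symmetric matrices, and the theorem -/

theorem exists_le_integral (α β γ : ℝ) {p : ℝ} (hp0 : 0 < p) (hp1 : p < 1) (x₀ : Plane) {R : ℝ}
    (hR : 0 < R) :
    ∃ s : ℝ, 0 < s ∧ ∀ u : Plane → ℝ, ContDiff ℝ 2 u →
      (∀ x ∈ ball x₀ R, 1 ≤ quadHess α β γ u x) → s ≤ ∫ x in ball x₀ R, |u x| ^ p := by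
  rcases le_or_gt (α * γ - β ^ 2) 0 with hd | hd
  · exact exists_le_integral_of_nonelliptic hd hp0 hp1 x₀ hR
  rcases lt_or_ge 0 (α + γ) with hτ | hτ
  · exact exists_le_integral_of_elliptic hτ hd hp0 hp1 x₀ hR
  -- Trace zero is incompatible with positive determinant, so A is negative definite and -A, -u fit
  -- the elliptic case.
  · have hτ' : 0 < -α + -γ := by
      by_contra! h
      nlinarith [sq_nonneg (α - γ), sq_nonneg β, show α + γ = 0 by linarith]
    obtain ⟨s, hs, H⟩ := exists_le_integral_of_elliptic (α := -α) (β := -β) (γ := -γ) hτ'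
      (by linarith) hp0 hp1 x₀ hR
    refine ⟨s, hs, fun u hu h => ?_⟩
    simpa using H (-u) hu.neg fun x hx => by simpa [quadHess_neg] using h x hx

theorem mainTheorem7 (a : Matrix (Fin 2) (Fin 2) ℝ)
    (Ω : Set (EuclideanSpace ℝ (Fin 2))) (hΩ : IsOpen Ω) (hΩb : Bornology.IsBounded Ω)
    (hΩn : Ω.Nonempty) (p : ℝ) (hp0 : 0 < p) (hp1 : p < 1) :
    ∃ c : ℝ, 0 < c ∧ ∀ u : EuclideanSpace ℝ (Fin 2) → ℝ,
      ContDiffOn ℝ 2 u Ω → (∀ x ∈ Ω, 1 ≤ secondOrderOp a u x) →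
        ENNReal.ofReal c ≤ eLpNorm u (ENNReal.ofReal p) (volume.restrict Ω) := by
  obtain ⟨x₀, hx₀⟩ := hΩn
  obtain ⟨ε, hε, hεΩ⟩ := nhds_basis_closedBall.mem_iff.1 (hΩ.mem_nhds hx₀)
  have hR : 0 < ε / 2 := by positivity
  have hBΩ : closedBall x₀ (2 * (ε / 2)) ⊆ Ω := by rwa [mul_div_cancel₀ ε two_ne_zero]
  have hbΩ : ball x₀ (ε / 2) ⊆ Ω :=
    (ball_subset_ball (by linarith)).trans (ball_subset_closedBall.trans hBΩ)
  obtain ⟨s, hs, H⟩ := exists_le_integral (a 0 0) ((a 0 1 + a 1 0) / 2) (a 1 1) hp0 hp1 x₀ hR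
  refine ⟨s ^ (1 / p), by positivity, fun u hu hD => ?_⟩
  obtain ⟨v, hv, hvu⟩ := hu.exists_contDiff_eventuallyEq hΩ hR hBΩ
  have hsv := H v hv fun x hx => by
    rw [← secondOrderOp_eq_quadHess a hv, secondOrderOp_congr a (hvu x hx)]
    exact hD x (hbΩ hx)
  have hlint : ENNReal.ofReal s ≤ ∫⁻ x in ball x₀ (ε / 2), ‖u x‖ₑ ^ p := by
    calc ENNReal.ofReal s ≤ ENNReal.ofReal (∫ x in ball x₀ (ε / 2), |v x| ^ p) :=
          ENNReal.ofReal_le_ofReal hsv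
      _ = ∫⁻ x in ball x₀ (ε / 2), ENNReal.ofReal (|v x| ^ p) :=
          ofReal_integral_eq_lintegral_ofReal
            ((hv.continuous.abs_rpow hp0).integrableOn_ball x₀ (ε / 2))
            (ae_of_all _ fun x => by positivity)
      _ = ∫⁻ x in ball x₀ (ε / 2), ‖u x‖ₑ ^ p :=
          setLIntegral_congr_fun measurableSet_ball fun x hx => by
            simp only [(hvu x hx).eq_of_nhds]
            rw [← ENNReal.ofReal_rpow_of_nonneg (abs_nonneg _) hp0.le, Real.enorm_eq_ofReal_abs]
  rw [eLpNorm_eq_lintegral_rpow_enorm_toReal (by simpa using hp0) ENNReal.ofReal_ne_top,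
    ENNReal.toReal_ofReal hp0.le, ← ENNReal.ofReal_rpow_of_pos hs]
  exact ENNReal.rpow_le_rpow (hlint.trans (lintegral_mono_set hbΩ)) (by positivity)
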